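/- Let $G$ be a finite graph and let $\ll$ be a linear order of its vertices. First-Fit processes the vertices of $G$ in the order $\ll$ and assigns to each vertex the least positive integer that is not the color of one of its previously colored neighbors. Let $\chi_{\mathrm{FF}}(G,\ll)$ be the number of different colors it uses, let $\chi(G)$ be the chromatic number of $G$, and let $\mathbb{E}_{\ll}$ be the expectation over an order $\ll$ chosen uniformly at random among all linear orders of the vertex set. For the class $\mathcal{F}$ of forests (graphs without cycles) put \[ \mathrm{RFF}_{\mathcal{F}}(n)=\max_{G\in\mathcal{F},\ |V(G)|=n}\ \mathbb{E}_{\ll}\left[\frac{\chi_{\mathrm{FF}}(G,\ll)}{\chi(G)}\right]. \] Then, as $n\to\infty$, \[ \mathrm{RFF}_{\mathcal{F}}(n)=\left(\tfrac12\pm o(1)\right)\cdot\frac{\ln n}{\ln\ln n}. \] -/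

import Mathlib

open Filter Topology BigOperators

namespace RandomFirstFit

/-- A presentation order of the vertices of `V`: a bijection sending each vertex to its
arrival time, so that `u` is presented before `v` iff `π u < π v`. -/
abbrev PresentationOrder (V : Type) [Fintype V] : Type := V ≃ Fin (Fintype.card V)

/-- The color that First-Fit assigns to `v` when the vertices of `G` arrive in the order `π`:
the least positive integer which is not the color of an earlier neighbor of `v`. -/
noncomputable def ffColor {V : Type} [Fintype V] (G : SimpleGraph V) (π : PresentationOrder V)
    (v : V) : ℕ :=
  sInf {i : ℕ | 1 ≤ i ∧ ∀ u : V, G.Adj u v → (h : π u < π v) → ffColor G π u ≠ i}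
termination_by π v
decreasing_by exact h

/-- The number of different colors used by First-Fit on `G` in the order `π`. -/
noncomputable def ffNumColors {V : Type} [Fintype V] (G : SimpleGraph V)
    (π : PresentationOrder V) : ℕ :=
  (Finset.univ.image (ffColor G π)).card

open Classical in
/-- The performance ratio of First-Fit on `G` in the random arrival model: the expectation of
`(number of colors used) / χ(G)` over a uniformly random presentation order, that is, the average
of this quantity over all (finitely many) presentation orders. -/
noncomputable def performanceRatio {V : Type} [Fintype V] (G : SimpleGraph V) : ℝ :=
  𝔼 π : PresentationOrder V, (ffNumColors G π : ℝ) / (G.chromaticNumber.toNat : ℝ)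

/-- The set of performance ratios of First-Fit on the `n`-vertex graphs of the class `𝒢`. -/
def ratios (𝒢 : ∀ V : Type, Set (SimpleGraph V)) (n : ℕ) : Set ℝ :=
  {x | ∃ (V : Type) (_ : Fintype V) (G : SimpleGraph V),
    G ∈ 𝒢 V ∧ Fintype.card V = n ∧ x = performanceRatio G}

/-- The performance ratio of First-Fit on the `n`-vertex graphs of the class `𝒢`: the largest
performance ratio of such a graph. -/
noncomputable def RFF (𝒢 : ∀ V : Type, Set (SimpleGraph V)) (n : ℕ) : ℝ :=
  sSup (ratios 𝒢 n)

/-- The class of forests. -/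
def forests : ∀ V : Type, Set (SimpleGraph V) := fun _ => {G | G.IsAcyclic}

end RandomFirstFit

/-! Upper bound. Root every tree of the forest. A vertex of color `c` has earlier neighbors of
colors `c - 1` and `c - 2`, and at most one of them is its parent. Descending from the other one
through children whose colors drop by one gives `c - 1` vertices `w, p w, p (p w), …` that arrive in
this order (`exists_chain`). A fixed chain does so with probability at most `1/(c-1)!`, and it is
determined by its start `w`, so color `c` occurs with probability at most `n/(c-1)!`. Once `n ≤ K!`
these bounds decay geometrically beyond `K`, and the expected number of colors is at most `K + 2`
(`sum_ffNumColors_le`). Since `log K!` is about `K log K`, some `K` close to `ln n / ln ln n` is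
enough; division by `χ = 2` gives the factor `1/2`.

Lower bound. On `HangingTree N k`, with `(N+1)^k` vertices, First-Fit reaches color `k + 1` at the
root if, recursively, the copy `none` succeeds and so does some hung copy whose root precedes the
main root. A random order is replaced by independent uniform slots in `Fin M` with ties broken
arbitrarily, which makes the copies independent (`goodProb_succ`). With `N` about `(ln n)^(1+δ)` and
`M` a large constant times `k + 1`, success is likely (`le_card_good`), while `(N+1)^k ≤ n` still
allows `k` close to `ln n / ln ln n`. -/

namespace RandomFirstFit

/-! ### First-Fit colors and increasing chains in rooted forests -/

section FirstFit

variable {V : Type} [Fintype V] {G : SimpleGraph V} {π : PresentationOrder V} {u v : V}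

theorem ffColor_eq_sInf (G : SimpleGraph V) (π : PresentationOrder V) (v : V) :
    ffColor G π v = sInf {i : ℕ | 1 ≤ i ∧ ∀ u, G.Adj u v → π u < π v → ffColor G π u ≠ i} := by
  rw [ffColor]

theorem ffColor_mem (G : SimpleGraph V) (π : PresentationOrder V) (v : V) :
    ffColor G π v ∈ {i : ℕ | 1 ≤ i ∧ ∀ u, G.Adj u v → π u < π v → ffColor G π u ≠ i} := by
  rw [ffColor_eq_sInf]
  apply Nat.sInf_mem
  refine ⟨(∑ u, ffColor G π u) + 1, by omega, fun u _ _ h => ?_⟩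
  have := Finset.single_le_sum (f := ffColor G π) (fun _ _ => Nat.zero_le _) (Finset.mem_univ u)
  omega

theorem one_le_ffColor (G : SimpleGraph V) (π : PresentationOrder V) (v : V) :
    1 ≤ ffColor G π v := (ffColor_mem G π v).1

theorem ffColor_ne (h : G.Adj u v) (h' : π u < π v) : ffColor G π u ≠ ffColor G π v :=
  (ffColor_mem G π v).2 u h h'

theorem ffColor_le {i : ℕ} (hi : 1 ≤ i)
    (h : ∀ u, G.Adj u v → π u < π v → ffColor G π u ≠ i) : ffColor G π v ≤ i := by
  rw [ffColor_eq_sInf]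
  exact Nat.sInf_le ⟨hi, h⟩

theorem exists_ffColor_eq_of_lt {i : ℕ} (hi : 1 ≤ i) (h : i < ffColor G π v) :
    ∃ u, G.Adj u v ∧ π u < π v ∧ ffColor G π u = i := by
  by_contra! hc
  exact absurd (ffColor_le hi hc) (by omega)

theorem ffColor_le_ffNumColors (G : SimpleGraph V) (π : PresentationOrder V) (v : V) :
    ffColor G π v ≤ ffNumColors G π := by
  have : Finset.Icc 1 (ffColor G π v) ⊆ Finset.univ.image (ffColor G π) := by
    intro i hi
    rw [Finset.mem_Icc] at hi
    rcases hi.2.eq_or_lt with h | h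
    · exact Finset.mem_image.2 ⟨v, Finset.mem_univ _, h.symm⟩
    · obtain ⟨u, -, -, hu⟩ := exists_ffColor_eq_of_lt hi.1 h
      exact Finset.mem_image.2 ⟨u, Finset.mem_univ _, hu⟩
  simpa [ffNumColors] using Finset.card_le_card this

theorem ffNumColors_le_card (G : SimpleGraph V) (π : PresentationOrder V) :
    ffNumColors G π ≤ Fintype.card V := Finset.card_image_le

theorem ffColor_le_card (G : SimpleGraph V) (π : PresentationOrder V) (v : V) :
    ffColor G π v ≤ Fintype.card V :=
  (ffColor_le_ffNumColors G π v).trans (ffNumColors_le_card G π)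

theorem ffNumColors_bot_le_one (π : PresentationOrder V) :
    ffNumColors (⊥ : SimpleGraph V) π ≤ 1 := by
  refine Finset.card_le_one.2 ?_
  have h : ∀ v, ffColor (⊥ : SimpleGraph V) π v = 1 := fun v =>
    le_antisymm (ffColor_le le_rfl (fun u h => absurd h (by simp))) (one_le_ffColor _ _ _)
  simp [h]

/-- A function `p` orients a forest if every edge joins a vertex to its parent under `p`. -/
def IsParent (G : SimpleGraph V) (p : V → V) : Prop :=
  ∀ u v, G.Adj u v → p u = v ∨ p v = u

omit [Fintype V] in
-- The parent is the next vertex on the path to a chosen representative of the component; the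
-- representative is its own parent.
theorem exists_isParent (hG : G.IsAcyclic) : ∃ p : V → V, IsParent G p := by
  classical
  let r : V → V := fun v => (G.connectedComponentMk v).out
  have hr : ∀ v, G.Reachable v (r v) := fun v =>
    (SimpleGraph.ConnectedComponent.exact (G.connectedComponentMk v).out_eq).symm
  have hr' : ∀ u v, G.Adj u v → r u = r v := fun u v h => by
    have : G.connectedComponentMk u = G.connectedComponentMk v :=
      SimpleGraph.ConnectedComponent.sound h.reachable
    simp only [r, this]
  have hex : ∀ v, ∃ q : G.Walk v (r v), q.IsPath := fun v => (hr v).exists_isPath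
  choose q hq using hex
  refine ⟨fun v => (q v).snd, fun u v h => ?_⟩
  by_cases hv : v ∈ (q u).support
  · exact Or.inl (hG.eq_snd_of_adj_start (hq u) h hv).symm
  · right
    -- If `v` is off the path of `u`, prepending `v` to it gives a path, which by uniqueness is the
    -- path of `v`.
    have hp : (SimpleGraph.Walk.cons h.symm ((q u).copy rfl (hr' u v h))).IsPath := by
      rw [SimpleGraph.Walk.cons_isPath_iff]
      exact ⟨by simpa using hq u, by simpa using hv⟩
    have h2 := congrArg Subtype.val ((hG.subsingleton_path _ _).elim ⟨_, hp⟩ ⟨_, hq v⟩)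
    simp only at h2 ⊢
    rw [← h2]
    simp

/-- In a forest oriented by `p`, a vertex with color `j` whose parent is not an earlier neighbor is
the end of an increasing chain of `j` iterated parents. -/
theorem exists_chain_of_parent {p : V → V} (hp : IsParent G p) (j : ℕ) (hj : 1 ≤ j) :
    ∀ u, ffColor G π u = j → π u ≤ π (p u) →
      ∃ w, p^[j - 1] w = u ∧ ∀ i, i < j - 1 → π (p^[i] w) < π (p^[i + 1] w) := by
  induction j, hj using Nat.le_induction with
  | base => exact fun u _ _ => ⟨u, rfl, fun i hi => by omega⟩
  | succ j hj ih =>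
    intro u hu hpu
    obtain ⟨x, hxu, hlt, hx⟩ := exists_ffColor_eq_of_lt (i := j) hj (by omega : j < ffColor G π u)
    have hpx : p x = u := by
      rcases hp x u hxu with h | h
      · exact h
      · rw [h] at hpu; exact absurd hlt (not_lt.2 hpu)
    obtain ⟨w, hw, hinc⟩ := ih x hx (by rw [hpx]; exact hlt.le)
    have e1 : j + 1 - 1 = (j - 1) + 1 := by omega
    refine ⟨w, by rw [e1, Function.iterate_succ_apply', hw, hpx], fun i hi => ?_⟩
    rcases (show i ≤ j - 1 by omega).eq_or_lt with h | h
    · rw [h, Function.iterate_succ_apply', hw, hpx]; exact hlt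
    · exact hinc i h

theorem exists_chain {p : V → V} (hp : IsParent G p) {c : ℕ} (hc : 3 ≤ c)
    (h : ffColor G π v = c) :
    ∃ w, StrictMono fun i : Fin (c - 1) => π (p^[i] w) := by
  -- The earlier neighbors of colors `c - 1` and `c - 2` are distinct, so they cannot both be the
  -- parent of `v`; one of them is a child.
  have key : ∃ j x, c - 2 ≤ j ∧ ffColor G π x = j ∧ p x = v ∧ π x < π v := by
    obtain ⟨x, hx, hlt, hxc⟩ :=
      exists_ffColor_eq_of_lt (i := c - 1) (by omega) (by omega : c - 1 < ffColor G π v)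
    obtain ⟨y, hy, hlt', hyc⟩ :=
      exists_ffColor_eq_of_lt (i := c - 2) (by omega) (by omega : c - 2 < ffColor G π v)
    rcases hp x v hx with h1 | h1
    · exact ⟨c - 1, x, by omega, hxc, h1, hlt⟩
    rcases hp y v hy with h2 | h2
    · exact ⟨c - 2, y, le_rfl, hyc, h2, hlt'⟩
    · rw [← h1, h2] at hxc; omega
  obtain ⟨j, x, hj, hx, hpx, hlt⟩ := key
  obtain ⟨w, hw, hinc⟩ := exists_chain_of_parent hp j (by omega) x hx (by rw [hpx]; exact hlt.le)
  have hinc' : ∀ i, i < j → π (p^[i] w) < π (p^[i + 1] w) := by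
    intro i hi
    rcases (show i ≤ j - 1 by omega).eq_or_lt with h | h
    · rw [h, Function.iterate_succ_apply', hw, hpx]; exact hlt
    · exact hinc i h
  refine ⟨w, ?_⟩
  obtain ⟨m, hm⟩ : ∃ m, c - 1 = m + 1 := ⟨c - 2, by omega⟩
  rw [hm]
  refine Fin.strictMono_iff_lt_succ.2 fun i => ?_
  have := hinc' i (by omega)
  simpa using this

end FirstFit

/-! ### Probability that a given chain is increasing -/

section Chains

variable {V : Type} [Fintype V]

open Classical in
/-- Exactly one in `m!` orders is increasing along `m` given vertices. -/
theorem card_strictMono_mul_factorial_le {m : ℕ} (e : Fin m → V) :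
    (Finset.univ.filter fun π : PresentationOrder V => StrictMono fun i => π (e i)).card
      * m.factorial ≤ (Fintype.card V).factorial := by
  by_cases he : Function.Injective e
  swap
  · rw [Finset.filter_false_of_mem, Finset.card_empty, zero_mul]
    · exact Nat.zero_le _
    · intro π _ h
      exact he fun a b hab => h.injective (by simp only [hab])
  let e' : Fin m ↪ V := ⟨e, he⟩
  have hV : (Fintype.card V).factorial = (Finset.univ : Finset (PresentationOrder V)).card := by
    rw [Finset.card_univ, Fintype.card_equiv (Fintype.equivFin V)]
  have hm : m.factorial = (Finset.univ : Finset (Equiv.Perm (Fin m))).card := by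
    rw [Finset.card_univ, Fintype.card_perm, Fintype.card_fin]
  rw [hV, hm, ← Finset.card_product]
  -- An increasing order together with a permutation of the `m` vertices gives an order. Both can be
  -- recovered: the set of values taken on the chain, once sorted, determines the increasing order
  -- there, and hence the permutation.
  refine Finset.card_le_card_of_injOn
    (fun x => (x.2.viaFintypeEmbedding e').trans x.1) (fun _ _ => Finset.mem_univ _) ?_
  rintro ⟨π, σ⟩ h ⟨π', σ'⟩ h' heq
  simp only [Finset.coe_product, Set.mem_prod, Finset.mem_coe, Finset.mem_filter,
    Finset.mem_univ, true_and, and_true] at h h'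
  have hval : ∀ i, π (e (σ i)) = π' (e (σ' i)) := fun i => by
    have := congrArg (fun ρ : PresentationOrder V => ρ (e' i)) heq
    simp only [Equiv.trans_apply, Equiv.Perm.viaFintypeEmbedding_apply_image] at this
    exact this
  have hfun : (fun i => π (e i)) = fun i => π' (e i) := by
    refine (h.range_inj h').1 ?_
    ext x
    constructor
    · rintro ⟨i, rfl⟩
      exact ⟨σ' (σ.symm i), by simpa using (hval (σ.symm i)).symm⟩
    · rintro ⟨i, rfl⟩
      exact ⟨σ (σ'.symm i), by simpa using (hval (σ'.symm i))⟩
  have hσ : σ = σ' := by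
    ext1 i
    have := hval i
    rw [show π' (e (σ' i)) = π (e (σ' i)) from (congrFun hfun (σ' i)).symm] at this
    exact he (π.injective this)
  subst hσ
  have hπ : π = π' := by
    ext1 v
    have := congrArg (fun ρ : PresentationOrder V =>
      ρ ((σ.viaFintypeEmbedding e').symm v)) heq
    simpa using this
  rw [hπ]

end Chains

/-! ### A criterion for acyclicity -/

section Acyclic

variable {V : Type} {G : SimpleGraph V}

/-- On a cycle, both neighbors of a vertex of maximal height would have to be its parent, although
they are distinct. -/
theorem isAcyclic_of_parent {p : V → V} {h : V → ℕ}
    (hp : ∀ u v, G.Adj u v → (p u = v ∧ h v < h u) ∨ (p v = u ∧ h u < h v)) : G.IsAcyclic := by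
  classical
  intro r c hc
  obtain ⟨v, hv, hmax⟩ := c.support.toFinset.exists_max_image h ⟨r, by simp⟩
  rw [List.mem_toFinset] at hv
  have hc' : (c.rotate v hv).IsCycle := hc.rotate hv
  have hmax' : ∀ x ∈ (c.rotate v hv).support, h x ≤ h v := fun x hx =>
    hmax x (by rw [List.mem_toFinset]; exact (c.mem_support_rotate_iff v hv).1 hx)
  set d := c.rotate v hv
  have h1 : p v = d.snd := by
    have := hmax' d.snd (d.getVert_mem_support 1)
    rcases hp v d.snd (d.adj_snd hc'.not_nil) with h | h
    · exact h.1
    · omega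
  have h2 : p v = d.penultimate := by
    have := hmax' d.penultimate (d.getVert_mem_support _)
    rcases hp d.penultimate v (d.adj_penultimate hc'.not_nil) with h | h
    · omega
    · exact h.1
  exact hc'.snd_ne_penultimate (h1.symm.trans h2)

end Acyclic

/-! ### The maximum is attained; upper bound for forests -/

section Ratio

variable {V : Type} [Fintype V] {G : SimpleGraph V}

theorem card_presentationOrder (V : Type) [Fintype V] [DecidableEq V] :
    Fintype.card (PresentationOrder V) = (Fintype.card V).factorial :=
  Fintype.card_equiv (Fintype.equivFin V)

theorem performanceRatio_eq [DecidableEq V] (G : SimpleGraph V) :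
    performanceRatio G = ((∑ π : PresentationOrder V, ffNumColors G π : ℕ) : ℝ) /
      ((Fintype.card V).factorial : ℝ) / (G.chromaticNumber.toNat : ℝ) := by
  obtain rfl : ‹DecidableEq V› = fun a b => Classical.propDecidable (a = b) :=
    Subsingleton.elim _ _
  classical
  rw [performanceRatio, Fintype.expect_eq_sum_div_card, ← Finset.sum_div,
    card_presentationOrder, Nat.cast_sum, div_right_comm]

theorem chromaticNumber_toNat_le_card (G : SimpleGraph V) :
    G.chromaticNumber.toNat ≤ Fintype.card V := by
  have h := G.colorable_of_fintype.chromaticNumber_le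
  exact ENat.toNat_le_of_le_natCast h

/-- A ratio depends only on two bounded integers, the total number of colors over all orders and
`χ`, although `V` ranges over all types. Hence the supremum in `RFF` is a maximum. -/
theorem finite_ratios (𝒢 : ∀ V : Type, Set (SimpleGraph V)) (n : ℕ) : (ratios 𝒢 n).Finite := by
  classical
  refine Set.Finite.subset (((Set.finite_Iic (n.factorial * n)).prod (Set.finite_Iic n)).image
    fun x : ℕ × ℕ => (x.1 : ℝ) / (n.factorial : ℝ) / (x.2 : ℝ)) ?_
  rintro x ⟨V, _, G, -, rfl, rfl⟩
  refine ⟨(∑ π : PresentationOrder V, ffNumColors G π, G.chromaticNumber.toNat), ⟨?_, ?_⟩,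
    (performanceRatio_eq G).symm⟩
  · have := Finset.sum_le_card_nsmul (Finset.univ : Finset (PresentationOrder V))
      (ffNumColors G) (Fintype.card V) (fun π _ => ffNumColors_le_card G π)
    rwa [Finset.card_univ, card_presentationOrder, smul_eq_mul] at this
  · exact chromaticNumber_toNat_le_card G

theorem nonempty_ratios_forests (n : ℕ) : (ratios forests n).Nonempty :=
  ⟨_, Fin n, inferInstance, ⊥, SimpleGraph.isAcyclic_bot, Fintype.card_fin n, rfl⟩

theorem isGreatest_RFF_forests (n : ℕ) : IsGreatest (ratios forests n) (RFF forests n) :=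
  ⟨(nonempty_ratios_forests n).csSup_mem (finite_ratios _ n),
    fun _ hx => le_csSup (finite_ratios _ n).bddAbove hx⟩

open Classical in
-- Union bound over the starting vertex of the chain.
theorem card_exists_ffColor_eq_mul_factorial_le (hG : G.IsAcyclic) {c : ℕ} (hc : 3 ≤ c) :
    (Finset.univ.filter fun π : PresentationOrder V => ∃ v, ffColor G π v = c).card
      * (c - 1).factorial ≤ Fintype.card V * (Fintype.card V).factorial := by
  obtain ⟨p, hp⟩ := exists_isParent hG
  have hsub : (Finset.univ.filter fun π : PresentationOrder V => ∃ v, ffColor G π v = c) ⊆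
      Finset.univ.biUnion fun w : V => Finset.univ.filter fun π : PresentationOrder V =>
        StrictMono fun i : Fin (c - 1) => π (p^[i] w) := by
    intro π hπ
    obtain ⟨v, hv⟩ := (Finset.mem_filter.1 hπ).2
    obtain ⟨w, hw⟩ := exists_chain hp hc hv
    exact Finset.mem_biUnion.2 ⟨w, Finset.mem_univ _, Finset.mem_filter.2 ⟨Finset.mem_univ _, hw⟩⟩
  calc _ ≤ (∑ w : V, (Finset.univ.filter fun π : PresentationOrder V =>
        StrictMono fun i : Fin (c - 1) => π (p^[i] w)).card) * (c - 1).factorial :=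
        Nat.mul_le_mul_right _ ((Finset.card_le_card hsub).trans Finset.card_biUnion_le)
    _ ≤ ∑ _w : V, (Fintype.card V).factorial := by
        rw [Finset.sum_mul]
        exact Finset.sum_le_sum fun w _ =>
          card_strictMono_mul_factorial_le fun i : Fin (c - 1) => p^[i] w
    _ = _ := by simp

theorem ffNumColors_le_add_sum (G : SimpleGraph V) (π : PresentationOrder V) (K : ℕ)
    [∀ c, Decidable (∃ v, ffColor G π v = c)] :
    ffNumColors G π ≤ K + ∑ c ∈ Finset.Ioc K (Fintype.card V),
      if ∃ v, ffColor G π v = c then 1 else 0 := by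
  classical
  have : Finset.univ.image (ffColor G π) ⊆ Finset.Icc 1 K ∪
      (Finset.Ioc K (Fintype.card V)).filter fun c => ∃ v, ffColor G π v = c := by
    intro c hc
    obtain ⟨v, -, rfl⟩ := Finset.mem_image.1 hc
    have h1 := one_le_ffColor G π v
    have h2 := ffColor_le_card G π v
    by_cases h : ffColor G π v ≤ K
    · exact Finset.mem_union_left _ (Finset.mem_Icc.2 ⟨h1, h⟩)
    · exact Finset.mem_union_right _ (Finset.mem_filter.2
        ⟨Finset.mem_Ioc.2 ⟨by omega, h2⟩, v, rfl⟩)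
  have h := (Finset.card_le_card this).trans (Finset.card_union_le _ _)
  rw [Finset.card_filter] at h
  simpa [ffNumColors] using h

open Classical in
/-- The expected number of colors used on a forest is at most `K + 2` as soon as `n ≤ K!`. -/
theorem sum_ffNumColors_le (hG : G.IsAcyclic) {K : ℕ} (hK : 2 ≤ K)
    (hn : Fintype.card V ≤ K.factorial) :
    ((∑ π : PresentationOrder V, ffNumColors G π : ℕ) : ℝ) ≤
      (K + 2) * ((Fintype.card V).factorial : ℝ) := by
  set n := Fintype.card V with hn'
  have hpos : (0 : ℝ) < n.factorial := by exact_mod_cast n.factorial_pos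
  have h1 : (∑ π : PresentationOrder V, ffNumColors G π) ≤ n.factorial * K +
      ∑ c ∈ Finset.Ioc K n,
        (Finset.univ.filter fun π : PresentationOrder V => ∃ v, ffColor G π v = c).card := by
    calc _ ≤ ∑ π : PresentationOrder V, (K + ∑ c ∈ Finset.Ioc K n,
          if ∃ v, ffColor G π v = c then 1 else 0) :=
          Finset.sum_le_sum fun π _ => ffNumColors_le_add_sum G π K
      _ = _ := by
          rw [Finset.sum_add_distrib, Finset.sum_comm, Finset.sum_const, Finset.card_univ,
            card_presentationOrder, smul_eq_mul]
          simp only [Finset.card_filter]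
          rfl
  have h2 : ∀ c ∈ Finset.Ioc K n,
      ((Finset.univ.filter fun π : PresentationOrder V => ∃ v, ffColor G π v = c).card : ℝ) ≤
        (n.factorial : ℝ) * (1 / 2) ^ (c - (K + 1)) := by
    intro c hc
    rw [Finset.mem_Ioc] at hc
    have h3 := card_exists_ffColor_eq_mul_factorial_le hG (c := c) (by omega)
    -- Each factor of `(c - 1)!` beyond `K!` is at least `2`.
    have h4 : n * 2 ^ (c - (K + 1)) ≤ (c - 1).factorial := by
      have := Nat.factorial_mul_pow_le_factorial (m := K) (n := c - (K + 1))
      rw [show K + (c - (K + 1)) = c - 1 by omega] at this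
      exact (Nat.mul_le_mul hn (Nat.pow_le_pow_left (by omega) _)).trans this
    by_cases hn0 : n = 0
    · omega
    have hn1 : (0 : ℝ) < n := by exact_mod_cast Nat.pos_of_ne_zero hn0
    have h5 : ((Finset.univ.filter fun π : PresentationOrder V =>
        ∃ v, ffColor G π v = c).card : ℝ) * (n * 2 ^ (c - (K + 1))) ≤ n * n.factorial := by
      have := (Nat.mul_le_mul_left _ h4).trans h3
      exact_mod_cast this
    rw [one_div, inv_pow, ← div_eq_mul_inv, le_div_iff₀ (by positivity)]
    nlinarith [h5]
  have h3 : ∑ c ∈ Finset.Ioc K n, ((1 : ℝ) / 2) ^ (c - (K + 1)) ≤ 2 := by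
    have e : Finset.Ioc K n = Finset.Ico (K + 1) (n + 1) := by
      ext; simp only [Finset.mem_Ioc, Finset.mem_Ico]; omega
    rw [e, Finset.sum_Ico_eq_sum_range]
    simp only [Nat.add_sub_cancel_left]
    exact sum_geometric_two_le _
  calc ((∑ π : PresentationOrder V, ffNumColors G π : ℕ) : ℝ)
      ≤ (n.factorial : ℝ) * K + ∑ c ∈ Finset.Ioc K n, (n.factorial : ℝ) * (1 / 2) ^ (c - (K + 1)) := by
        refine (Nat.cast_le.2 h1).trans ?_
        push_cast
        exact add_le_add le_rfl (Finset.sum_le_sum h2)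
    _ ≤ _ := by
        rw [← Finset.mul_sum]
        nlinarith

theorem performanceRatio_le (hG : G.IsAcyclic) {K : ℕ} (hK : 2 ≤ K)
    (hn : Fintype.card V ≤ K.factorial) : performanceRatio G ≤ ((K : ℝ) + 2) / 2 := by
  classical
  have hpos : (0 : ℝ) < (Fintype.card V).factorial := by
    exact_mod_cast (Fintype.card V).factorial_pos
  have hK' : (2 : ℝ) ≤ K := by exact_mod_cast hK
  rw [performanceRatio_eq]
  have hle : G.chromaticNumber.toNat ≤ 2 := ENat.toNat_le_of_le_natCast hG.chromaticNumber_le_two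
  have htop : G.chromaticNumber ≠ ⊤ := ne_top_of_le_ne_top (by simp) hG.chromaticNumber_le_two
  -- The value `0` belongs to the empty graph, where division by zero makes the ratio `0`; the value
  -- `1` to edgeless graphs, which use one color.
  interval_cases hχ : G.chromaticNumber.toNat
  · simp; positivity
  · have h1 : G = ⊥ := by
      have : G.chromaticNumber = 1 := by
        rw [← ENat.natCast_toNat htop, hχ]; rfl
      exact (SimpleGraph.chromaticNumber_eq_one_iff.1 this).1
    subst h1
    have h2 : (∑ π : PresentationOrder V, ffNumColors (⊥ : SimpleGraph V) π) ≤
        (Fintype.card V).factorial := by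
      have := Finset.sum_le_card_nsmul (Finset.univ : Finset (PresentationOrder V))
        (ffNumColors ⊥) 1 (fun π _ => ffNumColors_bot_le_one π)
      rwa [Finset.card_univ, card_presentationOrder, smul_eq_mul, mul_one] at this
    have h3 : ((∑ π : PresentationOrder V, ffNumColors (⊥ : SimpleGraph V) π : ℕ) : ℝ) /
        ((Fintype.card V).factorial : ℝ) ≤ 1 := by
      rw [div_le_one hpos]; exact_mod_cast h2
    simp only [Nat.cast_one, div_one]
    linarith
  · rw [Nat.cast_ofNat]
    gcongr
    rw [div_le_iff₀ hpos]
    exact sum_ffNumColors_le hG hK hn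

theorem RFF_forests_le {n K : ℕ} (hK : 2 ≤ K) (hn : n ≤ K.factorial) :
    RFF forests n ≤ ((K : ℝ) + 2) / 2 := by
  refine csSup_le (nonempty_ratios_forests n) ?_
  rintro x ⟨V, _, G, hG, rfl, rfl⟩
  exact performanceRatio_le hG hK hn

end Ratio

/-! ### The extremal trees -/

section Tree

/-- The vertices of the tree obtained from a single vertex by `k` times hanging `N` copies of the
current tree under the root of one further copy, the copy `none`. -/
def HangingTree (N : ℕ) : ℕ → Type
  | 0 => Unit
  | k + 1 => Option (Fin N) × HangingTree N k

namespace HangingTree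

variable {N : ℕ}

noncomputable instance instFintype : (k : ℕ) → Fintype (HangingTree N k)
  | 0 => inferInstanceAs (Fintype Unit)
  | k + 1 => by
    letI := instFintype k
    exact inferInstanceAs (Fintype (Option (Fin N) × HangingTree N k))

theorem card (N k : ℕ) : Fintype.card (HangingTree N k) = (N + 1) ^ k := by
  induction k with
  | zero => rfl
  | succ k ih =>
    have : Fintype.card (HangingTree N (k + 1)) =
      Fintype.card (Option (Fin N) × HangingTree N k) :=
      Fintype.card_congr (Equiv.refl (Option (Fin N) × HangingTree N k))
    rw [this, Fintype.card_prod, ih, Fintype.card_option, Fintype.card_fin, pow_succ, mul_comm]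

def root : (k : ℕ) → HangingTree N k
  | 0 => ()
  | k + 1 => (none, root k)

/-- The vertex `x` of the copy `a` of the previous tree. -/
def copy {k : ℕ} (a : Option (Fin N)) (x : HangingTree N k) : HangingTree N (k + 1) := (a, x)

theorem root_succ (k : ℕ) : root (N := N) (k + 1) = copy none (root k) := rfl

theorem exists_eq_copy {k : ℕ} (x : HangingTree N (k + 1)) : ∃ a y, x = copy a y := ⟨x.1, x.2, rfl⟩

theorem copy_inj {k : ℕ} {a b : Option (Fin N)} {x y : HangingTree N k} :
    copy a x = copy b y ↔ a = b ∧ x = y := Prod.mk_inj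

def Adj : (k : ℕ) → HangingTree N k → HangingTree N k → Prop
  | 0, _, _ => False
  | k + 1, x, y => (x.1 = y.1 ∧ Adj k x.2 y.2) ∨
      (x.2 = root k ∧ y.2 = root k ∧ ((x.1 = none ∧ y.1 ≠ none) ∨ (x.1 ≠ none ∧ y.1 = none)))

theorem adj_copy {k : ℕ} {a b : Option (Fin N)} {x y : HangingTree N k} :
    Adj (k + 1) (copy a x) (copy b y) ↔ (a = b ∧ Adj k x y) ∨
      (x = root k ∧ y = root k ∧ ((a = none ∧ b ≠ none) ∨ (a ≠ none ∧ b = none))) := Iff.rfl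

theorem Adj.symm : ∀ {k : ℕ} {x y : HangingTree N k}, Adj k x y → Adj k y x
  | 0, _, _, h => h
  | k + 1, x, y, h => by
    rcases h with ⟨h1, h2⟩ | ⟨h1, h2, h3⟩
    · exact Or.inl ⟨h1.symm, h2.symm⟩
    · exact Or.inr ⟨h2, h1, by tauto⟩

theorem Adj.ne : ∀ {k : ℕ} {x y : HangingTree N k}, Adj k x y → x ≠ y
  | 0, _, _, h => h.elim
  | k + 1, x, y, h => by
    rintro rfl
    rcases h with ⟨-, h2⟩ | ⟨-, -, h3⟩
    · exact h2.ne rfl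
    · tauto

def graph (N k : ℕ) : SimpleGraph (HangingTree N k) where
  Adj := Adj k
  symm := ⟨fun _ _ h => h.symm⟩
  loopless := ⟨fun _ h => h.ne rfl⟩

theorem exists_parent_depth (N k : ℕ) :
    ∃ (p : HangingTree N k → HangingTree N k) (d : HangingTree N k → ℕ), d (root k) = 0 ∧
      ∀ u v, Adj k u v → (p u = v ∧ d v < d u) ∨ (p v = u ∧ d u < d v) := by
  classical
  induction k with
  | zero => exact ⟨id, fun _ => 0, rfl, fun _ _ h => h.elim⟩
  | succ k ih =>
    obtain ⟨p, d, hd, hp⟩ := ih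
    have hroot : ∀ u v, Adj k u v → d v < d u → u ≠ root k := by
      rintro u v - h rfl
      omega
    refine ⟨fun x => if x.2 = root k then copy none (root k) else copy x.1 (p x.2),
      fun x => d x.2 + if x.1 = none then 0 else 1, by simp [root, hd], fun u v h => ?_⟩
    obtain ⟨a, x, rfl⟩ := exists_eq_copy u
    obtain ⟨b, y, rfl⟩ := exists_eq_copy v
    rcases adj_copy.1 h with ⟨rfl, hxy⟩ | ⟨rfl, rfl, ⟨rfl, hb⟩ | ⟨ha, rfl⟩⟩
    · rcases hp x y hxy with ⟨h1, h2⟩ | ⟨h1, h2⟩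
      · exact Or.inl ⟨(if_neg (hroot x y hxy h2)).trans (congrArg (copy a) h1),
          Nat.add_lt_add_right h2 _⟩
      · exact Or.inr ⟨(if_neg (hroot y x hxy.symm h2)).trans (congrArg (copy a) h1),
          Nat.add_lt_add_right h2 _⟩
    · exact Or.inr ⟨if_pos rfl, by simp only [copy, hb, if_true, if_false]; omega⟩
    · exact Or.inl ⟨if_pos rfl, by simp only [copy, ha, if_true, if_false]; omega⟩

/-- The `r` isolated vertices pad the tree to any prescribed larger order. -/
theorem isAcyclic_sum_bot (N k r : ℕ) :
    (graph N k ⊕g (⊥ : SimpleGraph (Fin r))).IsAcyclic := by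
  obtain ⟨p, d, -, hp⟩ := exists_parent_depth N k
  refine isAcyclic_of_parent (p := Sum.map p id) (h := Sum.elim d fun _ => 0) ?_
  rintro (u | u) (v | v) h
  · simpa using hp u v (by simpa [graph] using h)
  · simp at h
  · simp at h
  · simp at h

/-- The order of the arrival slots `f` makes First-Fit use `k + 1` colors on the tree. -/
def Good {α : Type} [LT α] : (k : ℕ) → (HangingTree N k → α) → Prop
  | 0, _ => True
  | k + 1, f => Good k (fun x => f (copy none x)) ∧
      ∃ a : Fin N, Good k (fun x => f (copy (some a) x)) ∧
        f (copy (some a) (root k)) < f (copy none (root k))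

variable {V : Type} [Fintype V] {G : SimpleGraph V} {π : PresentationOrder V}

/-- The image under `φ` of a vertex other than the root has no neighbors but the obvious ones. -/
def IsCopy (G : SimpleGraph V) {k : ℕ} (φ : HangingTree N k → V) : Prop :=
  ∀ x, x ≠ root k → ∀ u, G.Adj u (φ x) ↔ ∃ y, u = φ y ∧ Adj k y x

omit [Fintype V] in
-- The exemption of the root in `IsCopy` is what lets the property descend: the root of a subcopy
-- has neighbors outside that subcopy.
theorem IsCopy.comp_copy {k : ℕ} {φ : HangingTree N (k + 1) → V} (h : IsCopy G φ)
    (a : Option (Fin N)) : IsCopy G (fun x => φ (copy a x)) := by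
  intro x hx u
  rw [h (copy a x) (by rw [root_succ, Ne, copy_inj]; tauto)]
  constructor
  · rintro ⟨y, rfl, hy⟩
    obtain ⟨b, y, rfl⟩ := exists_eq_copy y
    rcases adj_copy.1 hy with ⟨rfl, hyx⟩ | ⟨-, h2, -⟩
    · exact ⟨y, rfl, hyx⟩
    · exact absurd h2 hx
  · rintro ⟨y, rfl, hy⟩
    exact ⟨copy a y, rfl, adj_copy.2 (Or.inl ⟨rfl, hy⟩)⟩

omit [Fintype V] in
theorem IsCopy.adj_root {k : ℕ} {φ : HangingTree N k → V} (h : IsCopy G φ) {y : HangingTree N k}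
    (hy : Adj k y (root k)) : G.Adj (φ y) (φ (root k)) :=
  ((h y hy.ne (φ (root k))).2 ⟨root k, rfl, hy.symm⟩).symm

/-- When a child precedes the root, only its own children can block colors. The root of a hung copy
of level `k` sees, by induction, only colors at most `k` and so gets at most `k + 1`. -/
theorem IsCopy.ffColor_le {k : ℕ} {φ : HangingTree N k → V} (h : IsCopy G φ) :
    ∀ y, Adj k y (root k) → π (φ y) < π (φ (root k)) → ffColor G π (φ y) ≤ k := by
  induction k with
  | zero => exact fun y hy => hy.elim
  | succ k ih =>
    intro y hy hlt
    obtain ⟨a, y, rfl⟩ := exists_eq_copy y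
    rw [root_succ] at hy hlt
    rcases adj_copy.1 hy with ⟨rfl, hyr⟩ | ⟨rfl, -, ⟨-, h2⟩ | ⟨h2, -⟩⟩
    · exact (ih (h.comp_copy none) y hyr hlt).trans (Nat.le_succ k)
    · exact absurd rfl h2
    · refine RandomFirstFit.ffColor_le (by omega) fun u hu hult => ?_
      rw [h _ (by rw [root_succ, Ne, copy_inj]; tauto)] at hu
      obtain ⟨z, rfl, hz⟩ := hu
      obtain ⟨b, z, rfl⟩ := exists_eq_copy z
      rcases adj_copy.1 hz with ⟨rfl, hzr⟩ | ⟨rfl, -, ⟨rfl, -⟩ | ⟨-, h3⟩⟩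
      · have := ih (h.comp_copy _) z hzr hult
        omega
      · exact absurd hult hlt.asymm
      · exact absurd h3 h2

/-- Colors up to `k` come from the copy `none`. The hung root supplied by `Good` has all of them
among its earlier neighbors, so its color is at least `k + 1`, and `IsCopy.ffColor_le` makes this an
equality. -/
theorem IsCopy.exists_ffColor_eq {α : Type} [LT α] {k : ℕ} {φ : HangingTree N k → V}
    (h : IsCopy G φ) (f : HangingTree N k → α) (hf : ∀ x y, f x < f y → π (φ x) < π (φ y))
    (hgood : Good k f) : ∀ i, 1 ≤ i → i ≤ k →
      ∃ y, Adj k y (root k) ∧ π (φ y) < π (φ (root k)) ∧ ffColor G π (φ y) = i := by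
  induction k with
  | zero => intro i h1 h2; omega
  | succ k ih =>
    intro i h1 h2
    obtain ⟨hg, a, hga, hlt⟩ := hgood
    rcases h2.eq_or_lt with rfl | h2
    · have hadj : Adj (k + 1) (copy (some a) (root k)) (root (k + 1)) :=
        adj_copy.2 (Or.inr ⟨rfl, rfl, Or.inr ⟨by simp, rfl⟩⟩)
      refine ⟨copy (some a) (root k), hadj, hf _ _ hlt,
        le_antisymm (h.ffColor_le _ hadj (hf _ _ hlt)) ?_⟩
      by_contra! hc
      obtain ⟨y, hy, hylt, hyc⟩ := ih (h.comp_copy (some a)) _ (fun x y => hf _ _) hga _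
        (one_le_ffColor G π (φ (copy (some a) (root k)))) (by omega)
      exact ffColor_ne ((h.comp_copy (some a)).adj_root hy) hylt hyc
    · obtain ⟨y, hy, hylt, hyc⟩ := ih (h.comp_copy none) _ (fun x y => hf _ _) hg i h1 (by omega)
      exact ⟨copy none y, adj_copy.2 (Or.inl ⟨rfl, hy⟩), hylt, hyc⟩

theorem IsCopy.lt_ffNumColors {α : Type} [LT α] {k : ℕ} {φ : HangingTree N k → V}
    (h : IsCopy G φ) (f : HangingTree N k → α) (hf : ∀ x y, f x < f y → π (φ x) < π (φ y))
    (hgood : Good k f) : k + 1 ≤ ffNumColors G π := by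
  refine le_trans ?_ (ffColor_le_ffNumColors G π (φ (root k)))
  by_contra! hc
  obtain ⟨y, hy, hylt, hyc⟩ := h.exists_ffColor_eq f hf hgood _
    (one_le_ffColor G π (φ (root k))) (by omega)
  exact ffColor_ne (h.adj_root hy) hylt hyc

theorem isCopy_inl (N k r : ℕ) :
    IsCopy (graph N k ⊕g (⊥ : SimpleGraph (Fin r))) (Sum.inl : HangingTree N k → _) := by
  rintro x - (u | u)
  · simp [graph]
  · simp

end HangingTree

end Tree

/-! ### From independent slots to uniform orders -/

section Counting

variable {V : Type} [Fintype V]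

theorem exists_sorted {M : ℕ} (f : V → Fin M) :
    ∃ π : PresentationOrder V, ∀ u v, f u < f v → π u < π v := by
  let e := Fintype.equivFin V
  refine ⟨e.trans (Tuple.sort (f ∘ e.symm)).symm, fun u v h => ?_⟩
  by_contra! hc
  have := Tuple.monotone_sort (f ∘ e.symm) hc
  simp only [Function.comp_apply, Equiv.trans_apply, Equiv.apply_symm_apply,
    Equiv.symm_apply_apply] at this
  exact absurd h (not_lt.2 this)

/-- A property of independent uniform arrival slots which forces `X ≥ c` in all orders compatible
with the slots bounds the expectation of `X` over a uniform order from below. -/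
theorem card_slots_mul_le [DecidableEq V] {M c : ℕ} (P : (V → Fin M) → Prop) [DecidablePred P]
    (X : PresentationOrder V → ℕ)
    (h : ∀ f π, (∀ u v, f u < f v → π u < π v) → P f → c ≤ X π) :
    (Finset.univ.filter P).card * (Fintype.card V).factorial * c ≤
      M ^ Fintype.card V * ∑ π, X π := by
  -- Double counting over pairs `(f, τ)`: for fixed `τ` the slots `f ∘ τ` are uniform, for fixed `f`
  -- the order `τ.trans (s f)` is uniform, and the two are always compatible.
  choose s hs using fun f : V → Fin M => exists_sorted f
  have h1 : ∀ τ : Equiv.Perm V, ∑ f : V → Fin M, (if P (f ∘ τ) then c else 0) =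
      (Finset.univ.filter P).card * c := fun τ => by
    have e := (Equiv.arrowCongr τ.symm (Equiv.refl (Fin M))).sum_comp
      (fun f => if P f then c else 0)
    rw [show ∑ f : V → Fin M, (if P (f ∘ τ) then c else 0) = _ from e,
      ← Finset.sum_filter, Finset.sum_const, smul_eq_mul]
  have h2 : ∀ f : V → Fin M, ∑ τ : Equiv.Perm V, X (τ.trans (s f)) = ∑ π, X π := fun f =>
    Fintype.sum_equiv (Equiv.equivCongr (Equiv.refl V) (s f)) _ _ fun τ => rfl
  calc (Finset.univ.filter P).card * (Fintype.card V).factorial * c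
      = ∑ τ : Equiv.Perm V, ∑ f : V → Fin M, (if P (f ∘ τ) then c else 0) := by
        simp only [h1, Finset.sum_const, Finset.card_univ, Fintype.card_perm, smul_eq_mul]
        ring
    _ ≤ ∑ τ : Equiv.Perm V, ∑ f : V → Fin M, X (τ.trans (s f)) := by
        refine Finset.sum_le_sum fun τ _ => Finset.sum_le_sum fun f _ => ?_
        split_ifs with hP
        · exact h (f ∘ τ) _ (fun u v huv => hs f _ _ huv) hP
        · exact Nat.zero_le _
    _ = M ^ Fintype.card V * ∑ π, X π := by
        rw [Finset.sum_comm]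
        simp only [h2, Finset.sum_const, Finset.card_univ, smul_eq_mul, Fintype.card_fun,
          Fintype.card_fin]

end Counting

/-! ### Success probability on the trees -/

section Probability

theorem card_exists_mem {Ω : Type} [Fintype Ω] (N : ℕ) (T : Finset Ω)
    [DecidablePred fun g : Fin N → Ω => ∃ a, g a ∈ T] :
    ((Finset.univ.filter fun g : Fin N → Ω => ∃ a, g a ∈ T).card : ℝ) =
      (Fintype.card Ω : ℝ) ^ N - ((Fintype.card Ω : ℝ) - T.card) ^ N := by
  classical
  have h : (Finset.univ.filter fun g : Fin N → Ω => ∃ a, g a ∈ T)ᶜ =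
      Fintype.piFinset fun _ : Fin N => Tᶜ := by
    ext g; simp [Fintype.mem_piFinset]
  have h1 := Finset.card_add_card_compl (Finset.univ.filter fun g : Fin N → Ω => ∃ a, g a ∈ T)
  rw [h, Fintype.card_piFinset_const, Finset.card_compl, Fintype.card_fun, Fintype.card_fin] at h1
  have h2 : (((Finset.univ.filter fun g : Fin N → Ω => ∃ a, g a ∈ T).card
    + (Fintype.card Ω - T.card) ^ N : ℕ) : ℝ) = ((Fintype.card Ω) ^ N : ℕ) := by rw [h1]
  rw [Nat.cast_add, Nat.cast_pow, Nat.cast_pow, Nat.cast_sub (Finset.card_le_univ T)] at h2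
  linarith

namespace HangingTree

variable {N M : ℕ}

open Classical in
/-- The slot assignments which are good and put the root into the slot `s`. -/
noncomputable def goodAt (N M k : ℕ) (s : Fin M) : Finset (HangingTree N k → Fin M) :=
  Finset.univ.filter fun f => f (root k) = s ∧ Good k f

open Classical in
/-- The probability that a uniform slot assignment is good with the root in the slot `s`. -/
noncomputable def goodProb (N M k : ℕ) (s : Fin M) : ℝ :=
  ((goodAt N M k s).card : ℝ) / Fintype.card (HangingTree N k → Fin M)

theorem mem_goodAt {k : ℕ} {s : Fin M} {f : HangingTree N k → Fin M} :
    f ∈ goodAt N M k s ↔ f (root k) = s ∧ Good k f := by simp [goodAt]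

theorem disjoint_goodAt (N M k : ℕ) : Pairwise (Function.onFun Disjoint (goodAt N M k)) :=
  fun _ _ hne => Finset.disjoint_left.2 fun _ hf hf' =>
    hne ((mem_goodAt.1 hf).1.symm.trans (mem_goodAt.1 hf').1)

theorem goodProb_nonneg (k : ℕ) (s : Fin M) : 0 ≤ goodProb N M k s := by
  unfold goodProb; positivity

theorem goodProb_zero (s : Fin M) : goodProb N M 0 s = 1 / M := by
  classical
  have h1 : (goodAt N M 0 s).card = 1 := by
    rw [Finset.card_eq_one]
    refine ⟨fun _ => s, ?_⟩
    ext f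
    rw [mem_goodAt, Finset.mem_singleton]
    constructor
    · rintro ⟨h, -⟩
      funext x
      exact h
    · rintro rfl
      exact ⟨rfl, trivial⟩
  rw [goodProb, h1, Fintype.card_fun, card, Fintype.card_fin]
  simp

/-- Slot assignments of a tree are slot assignments of the copy `none` and of the other copies. -/
def funEquiv (N k : ℕ) (α : Type) : (HangingTree N (k + 1) → α) ≃
    (HangingTree N k → α) × (Fin N → HangingTree N k → α) where
  toFun f := (fun x => f (copy none x), fun a x => f (copy (some a) x))
  invFun g := fun x => match x with
    | (none, y) => g.1 y
    | (some a, y) => g.2 a y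
  left_inv f := by
    funext x
    obtain ⟨_ | a, y⟩ := x <;> rfl
  right_inv g := rfl

/-- The main root is the root of the copy `none`. Given its slot `s`, the `N` hung copies are
independent, and at least one must be good with its root strictly below `s`. -/
theorem goodProb_succ (hM : 0 < M) (k : ℕ) (s : Fin M) :
    goodProb N M (k + 1) s = goodProb N M k s *
      (1 - (1 - ∑ t ∈ Finset.Iio s, goodProb N M k t) ^ N) := by
  classical
  set Ω := HangingTree N k → Fin M
  have : NeZero M := ⟨hM.ne'⟩
  have hΩ : (0 : ℝ) < Fintype.card Ω := by exact_mod_cast Fintype.card_pos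
  set T : Finset Ω := (Finset.Iio s).biUnion (goodAt N M k) with hT
  have hTcard : (T.card : ℝ) = ∑ t ∈ Finset.Iio s, ((goodAt N M k t).card : ℝ) := by
    rw [hT, Finset.card_biUnion, Nat.cast_sum]
    exact (disjoint_goodAt N M k).set_pairwise _
  have hmemT : ∀ f, f ∈ T ↔ Good k f ∧ f (root k) < s := fun f => by
    rw [hT, Finset.mem_biUnion]
    constructor
    · rintro ⟨t, ht, hf⟩
      rw [mem_goodAt] at hf
      exact ⟨hf.2, by rw [hf.1]; exact Finset.mem_Iio.1 ht⟩
    · rintro ⟨h1, h2⟩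
      exact ⟨_, Finset.mem_Iio.2 h2, mem_goodAt.2 ⟨rfl, h1⟩⟩
  have hcard : (goodAt N M (k + 1) s).card = (goodAt N M k s).card *
      (Finset.univ.filter fun g : Fin N → Ω => ∃ a, g a ∈ T).card := by
    rw [← Finset.card_product, ← Finset.card_map (funEquiv N k (Fin M)).toEmbedding]
    congr 1
    ext ⟨f, g⟩
    rw [Finset.mem_map_equiv, Finset.mem_product, mem_goodAt, mem_goodAt, Finset.mem_filter]
    simp only [hmemT, Finset.mem_univ, true_and]
    constructor
    · rintro ⟨h1, h2, a, h3, h4⟩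
      exact ⟨⟨h1, h2⟩, a, h3, h4.trans_eq h1⟩
    · rintro ⟨⟨h1, h2⟩, a, h3, h4⟩
      exact ⟨h1, h2, a, h3, h4.trans_eq h1.symm⟩
  have htot : (Fintype.card (HangingTree N (k + 1) → Fin M) : ℝ) =
      Fintype.card Ω * (Fintype.card Ω : ℝ) ^ N := by
    rw [Fintype.card_congr (funEquiv N k (Fin M)), Fintype.card_prod, Fintype.card_fun (α := Fin N),
      Fintype.card_fin]
    push_cast
    rfl
  have hsum : 1 - ∑ t ∈ Finset.Iio s, goodProb N M k t =
      ((Fintype.card Ω : ℝ) - T.card) / Fintype.card Ω := by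
    rw [hTcard, sub_div, div_self hΩ.ne', Finset.sum_div]
    rfl
  rw [goodProb, hcard, htot, Nat.cast_mul, card_exists_mem, hsum, goodProb, div_pow]
  field_simp
  change _ * _ * (Fintype.card Ω : ℝ) = _
  ring

theorem sum_goodProb_le (hM : 0 < M) (k : ℕ) (S : Finset (Fin M)) :
    ∑ t ∈ S, goodProb N M k t ≤ 1 := by
  classical
  have : NeZero M := ⟨hM.ne'⟩
  have hΩ : (0 : ℝ) < Fintype.card (HangingTree N k → Fin M) := by exact_mod_cast Fintype.card_pos
  unfold goodProb
  rw [← Finset.sum_div, div_le_one hΩ, ← Nat.cast_sum, ← Finset.card_biUnion]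
  · exact_mod_cast Finset.card_le_univ _
  · exact (disjoint_goodAt N M k).set_pairwise _

/-- Each level costs one slot and a factor `1 - η`: the slot `s - 1` alone gives a hung copy success
probability at least `1/(2M)`, so all `N` fail with probability at most `η`. -/
theorem le_goodProb {η : ℝ} (h0 : 0 ≤ η) (h1 : η ≤ 1) (hM : 0 < M) {K : ℕ}
    (hη : (1 - 1 / (2 * M : ℝ)) ^ N ≤ η) (hK : 1 / 2 ≤ (1 - η) ^ K) (k : ℕ) (hk : k ≤ K) :
    ∀ s : Fin M, k ≤ s → (1 - η) ^ k / M ≤ goodProb N M k s := by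
  have hM' : (0 : ℝ) < M := by exact_mod_cast hM
  induction k with
  | zero => intro s _; rw [goodProb_zero, pow_zero]
  | succ k ih =>
    intro s hs
    have ih' := ih (by omega)
    rw [goodProb_succ hM, pow_succ, mul_div_right_comm]
    refine mul_le_mul (ih' s (by omega)) ?_ (by linarith) (goodProb_nonneg k s)
    have hb : 1 / (2 * M : ℝ) ≤ ∑ t ∈ Finset.Iio s, goodProb N M k t := by
      let t : Fin M := ⟨s - 1, by omega⟩
      have ht : t ∈ Finset.Iio s := by
        rw [Finset.mem_Iio, Fin.lt_def]; show (s : ℕ) - 1 < s; omega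
      refine le_trans ?_ (Finset.single_le_sum (fun t _ => goodProb_nonneg k t) ht)
      refine le_trans ?_ (ih' t (by show k ≤ (s : ℕ) - 1; omega))
      rw [← div_div]
      gcongr
      exact hK.trans (pow_le_pow_of_le_one (by linarith) (by linarith) (by omega))
    have := pow_le_pow_left₀ (sub_nonneg.2 (sum_goodProb_le (N := N) hM k (Finset.Iio s)))
      (sub_le_sub_left hb 1) N
    linarith

open Classical in
-- Sum over the `M - k` root slots `s ≥ k`, with Bernoulli's inequality for `(1 - η)^k`.
theorem le_card_good {η : ℝ} (h0 : 0 ≤ η) (h1 : η ≤ 1) (hM : 0 < M) {k : ℕ} (hkM : k ≤ M)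
    (hη : (1 - 1 / (2 * M : ℝ)) ^ N ≤ η) (hk : k * η ≤ 1 / 2) :
    (1 - k * η) * (1 - k / M) * (M : ℝ) ^ (N + 1) ^ k ≤
      ((Finset.univ.filter fun f : HangingTree N k → Fin M => Good k f).card : ℝ) := by
  have hM' : (0 : ℝ) < M := by exact_mod_cast hM
  have hbern : 1 - k * η ≤ (1 - η) ^ k := by
    have := one_add_mul_le_pow (a := -η) (by linarith) k
    rw [← sub_eq_add_neg] at this
    linarith
  have : NeZero M := ⟨hM.ne'⟩
  have hΩ : (0 : ℝ) < Fintype.card (HangingTree N k → Fin M) := by exact_mod_cast Fintype.card_pos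
  have hΩ' : (Fintype.card (HangingTree N k → Fin M) : ℝ) = (M : ℝ) ^ (N + 1) ^ k := by
    rw [Fintype.card_fun, card, Fintype.card_fin, Nat.cast_pow]
  set S : Finset (Fin M) := Finset.univ.filter fun s : Fin M => k ≤ s
  have hS : S.card = M - k := by
    have : S = Finset.univ.filter fun s : Fin M => ¬ (s : ℕ) < k := by ext; simp [S]
    have h := Finset.card_filter_add_card_filter_not (s := (Finset.univ : Finset (Fin M)))
      (fun s => (s : ℕ) < k)
    rw [← this, Fin.card_filter_val_lt, Finset.card_univ, Fintype.card_fin, min_eq_right hkM] at h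
    omega
  have hsum : (1 - k * η) * (1 - k / M) ≤ ∑ s ∈ S, goodProb N M k s := by
    calc (1 - k * η) * (1 - k / M) = S.card • ((1 - k * η) / M : ℝ) := by
          rw [hS, nsmul_eq_mul, Nat.cast_sub hkM]; field_simp
      _ ≤ ∑ s ∈ S, goodProb N M k s := by
          refine Finset.card_nsmul_le_sum _ _ _ fun s hs => ?_
          refine le_trans ?_ (le_goodProb h0 h1 hM hη (by linarith) k le_rfl s
            (Finset.mem_filter.1 hs).2)
          gcongr
  have hcard : ∑ s ∈ S, (goodAt N M k s).card ≤
      (Finset.univ.filter fun f : HangingTree N k → Fin M => Good k f).card := by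
    rw [← Finset.card_biUnion]
    · refine Finset.card_le_card fun f hf => ?_
      obtain ⟨s, -, hs⟩ := Finset.mem_biUnion.1 hf
      exact Finset.mem_filter.2 ⟨Finset.mem_univ _, (mem_goodAt.1 hs).2⟩
    · exact (disjoint_goodAt N M k).set_pairwise _
  unfold goodProb at hsum
  rw [← Finset.sum_div, le_div_iff₀ hΩ, hΩ'] at hsum
  exact hsum.trans (by exact_mod_cast hcard)

end HangingTree

theorem le_performanceRatio {V : Type} [Fintype V] [Nonempty V] {G : SimpleGraph V}
    (hG : G.IsAcyclic) [DecidableEq V] {M c : ℕ} (hM : 0 < M) (P : (V → Fin M) → Prop)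
    [DecidablePred P]
    (h : ∀ f π, (∀ u v, f u < f v → π u < π v) → P f → c ≤ ffNumColors G π) {q : ℝ}
    (hq : q * (M : ℝ) ^ Fintype.card V ≤ (Finset.univ.filter P).card) :
    q * (c / 2) ≤ performanceRatio G := by
  have hcount := card_slots_mul_le P (ffNumColors G) h
  have hfac : (0 : ℝ) < (Fintype.card V).factorial := by
    exact_mod_cast (Fintype.card V).factorial_pos
  have hχ2 : (G.chromaticNumber.toNat : ℝ) ≤ 2 := by
    exact_mod_cast ENat.toNat_le_of_le_natCast hG.chromaticNumber_le_two
  have hχ0 : (0 : ℝ) < G.chromaticNumber.toNat := by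
    have htop : G.chromaticNumber ≠ ⊤ := ne_top_of_le_ne_top (by simp) hG.chromaticNumber_le_two
    have := (G.colorable_of_fintype).chromaticNumber_pos
    rw [← ENat.natCast_toNat htop] at this
    exact_mod_cast this
  rw [performanceRatio_eq]
  generalize ∑ π : PresentationOrder V, ffNumColors G π = X at hcount ⊢
  have hcount' : ((Finset.univ.filter P).card : ℝ) * (Fintype.card V).factorial * c ≤
      (M : ℝ) ^ Fintype.card V * X := by exact_mod_cast hcount
  have hM' : (0 : ℝ) < (M : ℝ) ^ Fintype.card V := pow_pos (by exact_mod_cast hM) _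
  have hmain : q * c ≤ (X : ℝ) / (Fintype.card V).factorial := by
    rw [le_div_iff₀ hfac]
    refine le_of_mul_le_mul_left (le_trans ?_ hcount') hM'
    calc (M : ℝ) ^ Fintype.card V * (q * c * (Fintype.card V).factorial)
        = q * (M : ℝ) ^ Fintype.card V * ((Fintype.card V).factorial * c) := by ring
      _ ≤ (Finset.univ.filter P).card * ((Fintype.card V).factorial * c) := by gcongr
      _ = _ := by ring
  calc q * (c / 2) = q * c / 2 := by ring
    _ ≤ (X : ℝ) / (Fintype.card V).factorial / 2 := by gcongr
    _ ≤ _ := by gcongr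

open Classical in
theorem card_filter_comp_inl {α β γ : Type} [Fintype α] [Fintype β] [Fintype γ]
    (P : (α → γ) → Prop) :
    (Finset.univ.filter fun f : α ⊕ β → γ => P (fun x => f (Sum.inl x))).card =
      (Finset.univ.filter P).card * Fintype.card γ ^ Fintype.card β := by
  rw [← Fintype.card_fun, ← Finset.card_univ, ← Finset.card_product,
    ← Finset.card_map (Equiv.sumArrowEquivProdArrow α β γ).toEmbedding]
  congr 1
  ext ⟨f, g⟩
  rw [Finset.mem_map_equiv, Finset.mem_product, Finset.mem_filter, Finset.mem_filter]
  simp [Equiv.sumArrowEquivProdArrow]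

open HangingTree in
open Classical in
theorem le_RFF_forests {N M k n : ℕ} {η : ℝ} (h0 : 0 ≤ η) (h1 : η ≤ 1) (hM : 0 < M) (hkM : k ≤ M)
    (hη : (1 - 1 / (2 * M : ℝ)) ^ N ≤ η) (hk : k * η ≤ 1 / 2) (hn : (N + 1) ^ k ≤ n) :
    (1 - k * η) * (1 - k / M) * ((k + 1) / 2) ≤ RFF forests n := by
  obtain ⟨r, rfl⟩ := Nat.exists_eq_add_of_le hn
  have hac := isAcyclic_sum_bot N k r
  have hcard : Fintype.card (HangingTree N k ⊕ Fin r) = (N + 1) ^ k + r := by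
    rw [Fintype.card_sum, card, Fintype.card_fin]
  refine le_trans ?_ ((isGreatest_RFF_forests _).2 ⟨_, inferInstance, _, hac, hcard, rfl⟩)
  have : Nonempty (HangingTree N k ⊕ Fin r) := ⟨Sum.inl (root k)⟩
  have hpad := card_filter_comp_inl (β := Fin r) (Good (N := N) (α := Fin M) k)
  rw [Fintype.card_fin, Fintype.card_fin] at hpad
  have key := le_performanceRatio hac (c := k + 1) hM
    (fun f => Good k (fun x => f (Sum.inl x)))
    (fun f π hf hgood => (isCopy_inl N k r).lt_ffNumColors _ (fun x y h => hf _ _ h) hgood)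
    (q := (1 - k * η) * (1 - k / M)) (by
      have hgood := le_card_good h0 h1 hM hkM hη hk
      rw [hcard, pow_add, ← mul_assoc]
      refine (mul_le_mul_of_nonneg_right hgood (by positivity)).trans (le_of_eq ?_)
      rw [← Nat.cast_pow, ← Nat.cast_mul, ← hpad]
      congr!)
  exact_mod_cast key

end Probability

/-! ### Choice of parameters and the limit -/

section Asymptotics

open Real

theorem eventually_log_le_mul_rpow {r c : ℝ} (hr : 0 < r) (hc : 0 < c) :
    ∀ᶠ x : ℝ in atTop, log x ≤ c * x ^ r := by
  filter_upwards [(isLittleO_log_rpow_atTop hr).bound hc, eventually_ge_atTop 0] with x hx h0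
  have := rpow_nonneg h0 r
  rw [norm_of_nonneg this] at hx
  exact (le_abs_self _).trans hx

theorem exp_mul_log_sub_one_le_factorial {K : ℕ} (hK : 0 < K) :
    exp (K * (log K - 1)) ≤ (K.factorial : ℝ) := by
  have hK' : (0 : ℝ) < K := by exact_mod_cast hK
  have h := pow_div_factorial_le_exp _ hK'.le K
  have hf : (0 : ℝ) < K.factorial := by exact_mod_cast K.factorial_pos
  rw [div_le_iff₀ hf] at h
  have e : exp (K * (log K - 1)) = (K : ℝ) ^ K / exp K := by
    rw [mul_sub, mul_one, exp_sub, mul_comm, exp_mul, exp_log hK', rpow_natCast]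
  rw [e, div_le_iff₀ (exp_pos _), mul_comm]
  exact h

theorem tendsto_log_natCast : Tendsto (fun n : ℕ => log n) atTop atTop :=
  tendsto_log_atTop.comp tendsto_natCast_atTop_atTop

theorem eventually_RFF_forests_le {δ : ℝ} (hδ : 0 < δ) :
    ∀ᶠ n : ℕ in atTop, RFF forests n ≤ (1 + 2 * δ) / 2 * (log n / log (log n)) := by
  have h1 : ∀ᶠ ℓ : ℝ in atTop, log ℓ ≤ δ / (1 + δ) / 2 * ℓ := by
    simpa using eventually_log_le_mul_rpow one_pos (show 0 < δ / (1 + δ) / 2 by positivity)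
  have h2 : ∀ᶠ ℓ : ℝ in atTop, 1 ≤ δ / (1 + δ) / 2 * ℓ :=
    (tendsto_id.const_mul_atTop (show 0 < δ / (1 + δ) / 2 by positivity)).eventually_ge_atTop 1
  have h3 : ∀ᶠ L : ℝ in atTop, log L ≤ min (δ / 3) (1 / 2) * L := by
    simpa using eventually_log_le_mul_rpow one_pos (show 0 < min (δ / 3) (1 / 2) by positivity)
  filter_upwards [tendsto_log_natCast.eventually h3,
    (tendsto_log_atTop.comp tendsto_log_natCast).eventually (h1.and (h2.and (eventually_ge_atTop 1))),
    tendsto_log_natCast.eventually (eventually_gt_atTop 0), eventually_gt_atTop 0]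
    with n h3 ⟨h1, h2, hℓ1⟩ hL hn
  simp only [Function.comp_apply] at h1 h2 hℓ1
  set L := log n with hLdef
  set ℓ := log L with hℓdef
  have hℓ : 0 < ℓ := by linarith
  -- The `3` absorbs the `+ 2` of the upper bound and the rounding up of `x`.
  have hq : 2 ≤ L / ℓ ∧ 3 ≤ δ * (L / ℓ) := by
    have a := h3.trans (mul_le_mul_of_nonneg_right (min_le_left (δ / 3) (1 / 2)) hL.le)
    have b := h3.trans (mul_le_mul_of_nonneg_right (min_le_right (δ / 3) (1 / 2)) hL.le)
    rw [le_div_iff₀ hℓ, ← mul_div_assoc, le_div_iff₀ hℓ]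
    constructor <;> linarith
  set x := (1 + δ) * (L / ℓ) with hx
  have hxL : L / ℓ ≤ x := by rw [hx]; nlinarith
  have hx0 : 0 < x := by linarith
  have hKx : x ≤ (⌈x⌉₊ : ℝ) := Nat.le_ceil x
  have hK2 : 2 ≤ ⌈x⌉₊ := by
    have : (2 : ℝ) ≤ (⌈x⌉₊ : ℝ) := by linarith
    exact_mod_cast this
  -- `log ⌈x⌉₊ - 1 ≥ ℓ - log ℓ - 1`, and `log ℓ` and `1` each use at most half of the slack `ℓ - ℓ /
  -- (1 + δ)`.
  have hlog : ℓ / (1 + δ) ≤ log ⌈x⌉₊ - 1 := by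
    have a : log (L / ℓ) ≤ log ⌈x⌉₊ := log_le_log (by positivity) (by linarith)
    rw [log_div hL.ne' hℓ.ne', ← hℓdef] at a
    have b : ℓ / (1 + δ) = ℓ - (δ / (1 + δ) / 2 * ℓ + δ / (1 + δ) / 2 * ℓ) := by
      field_simp; ring
    rw [b]
    linarith
  have hfac : n ≤ (⌈x⌉₊).factorial := by
    have hLK : L ≤ ⌈x⌉₊ * (log ⌈x⌉₊ - 1) := by
      calc L = x * (ℓ / (1 + δ)) := by rw [hx]; field_simp
        _ ≤ _ := mul_le_mul hKx hlog (by positivity) (by positivity)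
    have := (exp_le_exp.2 hLK).trans (exp_mul_log_sub_one_le_factorial (by omega))
    rw [hLdef, exp_log (by exact_mod_cast hn)] at this
    exact_mod_cast this
  refine (RFF_forests_le hK2 hfac).trans ?_
  have := Nat.ceil_lt_add_one hx0.le
  linarith

set_option maxHeartbeats 1000000 in
theorem eventually_le_RFF_forests {δ : ℝ} (hδ : 0 < δ) (hδ' : δ ≤ 1 / 2) :
    ∀ᶠ n : ℕ in atTop, (1 - 3 * δ) / 2 * (log n / log (log n)) ≤ RFF forests n := by
  obtain ⟨m, hm⟩ := exists_nat_ge (1 / δ)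
  have hm' : 1 ≤ δ * m := by rwa [div_le_iff₀ hδ, mul_comm] at hm
  have hm0 : (0 : ℝ) < m := lt_of_lt_of_le (by positivity) hm
  filter_upwards [tendsto_log_natCast.eventually
      (eventually_log_le_mul_rpow hδ (show 0 < 1 / (16 * m : ℝ) by positivity)),
    (tendsto_log_atTop.comp tendsto_log_natCast).eventually (eventually_ge_atTop 1),
    tendsto_log_natCast.eventually (eventually_ge_atTop (max 4 (1 / δ))), eventually_gt_atTop 0]
    with n h1 hℓ1 hLmax hn
  simp only [Function.comp_apply] at hℓ1
  set L := log n with hLdef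
  set ℓ := log L with hℓdef
  have hL4 : 4 ≤ L := (le_max_left _ _).trans hLmax
  have hLδ : 1 / δ ≤ L := (le_max_right _ _).trans hLmax
  have hL0 : 0 < L := by linarith
  have hℓ : 0 < ℓ := by linarith
  -- With `N + 1 ≈ L^(1+δ)` and `k ≈ (1-δ) L/ℓ` the tree has at most `exp ((1-δ²) L) ≤ n` vertices.
  set y := L ^ (1 + δ) with hy
  have hyL : y = L * L ^ δ := by rw [hy, rpow_add hL0, rpow_one]
  have hLδ1 : 1 ≤ L ^ δ := one_le_rpow (by linarith) hδ.le
  have hy4 : 4 ≤ y := by rw [hyL]; nlinarith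
  have hfloor : 1 ≤ ⌊y⌋₊ := by rw [Nat.one_le_floor_iff]; linarith
  set x := (1 - δ) * (L / ℓ) with hx
  have hx0 : 0 ≤ x := mul_nonneg (by linarith) (by positivity)
  set k := ⌊x⌋₊
  have hkx : (k : ℝ) ≤ x := Nat.floor_le hx0
  have hkx' : x < k + 1 := Nat.lt_floor_add_one x
  have hxL : x ≤ L := by
    have a : L / ℓ ≤ L := div_le_self hL0.le hℓ1
    have b : 0 ≤ L / ℓ := by positivity
    rw [hx]; nlinarith
  set N := ⌊y⌋₊ - 1 with hN
  have hN1 : N + 1 = ⌊y⌋₊ := by omega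
  have hNy : y - 2 ≤ N := by
    have := Nat.lt_floor_add_one y
    rw [← hN1] at this
    push_cast at this
    linarith
  -- The factor `m ≥ 1/δ` gives `k / M ≤ δ`, while `M` stays `O(L)`, small enough against `N` for `η
  -- ≤ 1 / L ^ 2`.
  set M := m * (k + 1) with hM
  have hmpos : 0 < m := by exact_mod_cast hm0
  have hMpos : 0 < M := by positivity
  have hM' : (M : ℝ) = m * (k + 1) := by rw [hM]; push_cast; ring
  have hMpos' : (0 : ℝ) < M := by exact_mod_cast hMpos
  have hkM : k ≤ M := by rw [hM]; nlinarith
  set η := exp (-(N / (2 * M : ℝ))) with hηdef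
  have hη : (1 - 1 / (2 * M : ℝ)) ^ N ≤ η := by
    have a : 0 ≤ 1 - 1 / (2 * M : ℝ) := by
      have : (1 : ℝ) ≤ M := by exact_mod_cast hMpos
      rw [sub_nonneg, div_le_one (by positivity)]
      linarith
    calc (1 - 1 / (2 * M : ℝ)) ^ N ≤ exp (-(1 / (2 * M : ℝ))) ^ N :=
          pow_le_pow_left₀ a (one_sub_le_exp_neg _) N
      _ = η := by rw [← exp_nat_mul, hηdef]; congr 1; ring
  have hlog : 2 * ℓ ≤ N / (2 * M : ℝ) := by
    rw [le_div_iff₀ (by positivity)]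
    have a : ℓ * (16 * m) ≤ L ^ δ := by
      have := mul_le_mul_of_nonneg_right h1 (show (0 : ℝ) ≤ 16 * m by positivity)
      refine this.trans (le_of_eq ?_)
      field_simp
    have b : (M : ℝ) ≤ m * (2 * L) := by
      rw [hM']
      exact mul_le_mul_of_nonneg_left (by linarith) hm0.le
    have c : ℓ * M ≤ ℓ * (m * (2 * L)) := mul_le_mul_of_nonneg_left b hℓ.le
    have d : L * (ℓ * (16 * m)) ≤ L * L ^ δ := mul_le_mul_of_nonneg_left a hL0.le
    rw [← hyL] at d
    linarith
  have hkη : k * η ≤ δ := by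
    have a : η ≤ 1 / L ^ 2 := by
      calc η ≤ exp (-(2 * ℓ)) := exp_le_exp.2 (neg_le_neg hlog)
        _ = 1 / L ^ 2 := by
          rw [exp_neg, two_mul, exp_add, hℓdef, exp_log hL0, one_div, sq]
    calc k * η ≤ L * (1 / L ^ 2) :=
          mul_le_mul (by linarith) a (exp_pos _).le hL0.le
      _ = 1 / L := by field_simp
      _ ≤ δ := by rwa [one_div_le hL0 hδ]
  have hkM' : (k : ℝ) / M ≤ δ := by
    rw [div_le_iff₀ hMpos', hM']
    have : (0 : ℝ) ≤ k := Nat.cast_nonneg k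
    nlinarith
  have hsize : (N + 1) ^ k ≤ n := by
    have a : ((⌊y⌋₊ : ℝ)) ^ k ≤ n := by
      calc ((⌊y⌋₊ : ℝ)) ^ k ≤ y ^ k :=
            pow_le_pow_left₀ (Nat.cast_nonneg _) (Nat.floor_le (by linarith)) k
        _ = exp (ℓ * (1 + δ) * k) := by
            rw [hy, ← rpow_natCast, ← rpow_mul hL0.le, rpow_def_of_pos hL0, mul_assoc]
        _ ≤ exp L := by
            refine exp_le_exp.2 ?_
            calc ℓ * (1 + δ) * k ≤ ℓ * (1 + δ) * x :=
                  mul_le_mul_of_nonneg_left hkx (by positivity)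
              _ = (1 - δ ^ 2) * L := by rw [hx]; field_simp; ring
              _ ≤ L := by nlinarith [sq_nonneg δ]
        _ = n := by rw [hLdef, exp_log (by exact_mod_cast hn)]
    rw [hN1]
    exact_mod_cast a
  refine le_trans ?_ (le_RFF_forests (exp_pos _).le
    (exp_le_one_iff.2 (neg_nonpos.2 (by positivity))) hMpos hkM hη (by linarith) hsize)
  have hLℓ : 0 ≤ L / ℓ := by positivity
  have hprod : (1 - δ) * (1 - δ) ≤ (1 - k * η) * (1 - k / M) :=
    mul_le_mul (by linarith) (by linarith) (by linarith) (by linarith)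
  calc (1 - 3 * δ) / 2 * (L / ℓ) ≤ (1 - δ) * (1 - δ) * (x / 2) := by
        rw [hx]
        have : 1 - 3 * δ ≤ (1 - δ) * (1 - δ) * (1 - δ) := by nlinarith [sq_nonneg δ]
        nlinarith
    _ ≤ (1 - k * η) * (1 - k / M) * ((k + 1) / 2) :=
        mul_le_mul hprod (by linarith) (by linarith)
          ((mul_nonneg (by linarith) (by linarith)).trans hprod)

theorem log_div_log_log_pos {n : ℕ} (hn : 3 ≤ n) : 0 < log n / log (log n) := by
  have h3 : (3 : ℝ) ≤ n := by exact_mod_cast hn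
  have h1 : 1 < log n := by
    rw [lt_log_iff_exp_lt (by linarith)]
    linarith [exp_one_lt_d9]
  exact div_pos (by linarith) (log_pos h1)

theorem tendsto_RFF_forests_div :
    Tendsto (fun n : ℕ => RFF forests n / (log n / log (log n))) atTop (𝓝 (1 / 2)) := by
  rw [tendsto_order]
  constructor
  · intro a ha
    have hδ : 0 < min (1 / 2) ((1 / 2 - a) / 3) := lt_min (by norm_num) (by linarith)
    filter_upwards [eventually_le_RFF_forests hδ (min_le_left _ _), eventually_ge_atTop 3]
      with n h hn
    have hpos := log_div_log_log_pos hn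
    refine lt_of_lt_of_le ?_ ((le_div_iff₀ hpos).2 h)
    have := min_le_right (1 / 2) ((1 / 2 - a) / 3)
    linarith
  · intro a ha
    have hδ : 0 < (a - 1 / 2) / 2 := by linarith
    filter_upwards [eventually_RFF_forests_le hδ, eventually_ge_atTop 3] with n h hn
    have hpos := log_div_log_log_pos hn
    refine lt_of_le_of_lt ((div_le_iff₀ hpos).2 h) ?_
    linarith

end Asymptotics

end RandomFirstFit

theorem theorem1 :
    (∀ n : ℕ, IsGreatest (RandomFirstFit.ratios RandomFirstFit.forests n)
      (RandomFirstFit.RFF RandomFirstFit.forests n)) ∧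
    ∃ ε : ℕ → ℝ, Tendsto ε atTop (𝓝 0) ∧
      ∀ n : ℕ, 3 ≤ n →
        RandomFirstFit.RFF RandomFirstFit.forests n =
          (1 / 2 + ε n) * (Real.log n / Real.log (Real.log n)) := by
  refine ⟨RandomFirstFit.isGreatest_RFF_forests,
    fun n => RandomFirstFit.RFF RandomFirstFit.forests n / (Real.log n / Real.log (Real.log n))
      - 1 / 2, ?_, fun n hn => ?_⟩
  · simpa using RandomFirstFit.tendsto_RFF_forests_div.sub_const (1 / 2)
  · rw [add_sub_cancel, div_mul_cancel₀ _ (RandomFirstFit.log_div_log_log_pos hn).ne']
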